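/- For $s>1$ let $\mathbb{B}_s^d=\{x\in\mathbb{R}^d:\sum_{i=1}^d|x_i|^s\le 1\}$. There is a universal constant $c>0$ such that the following holds for all integers $n,d\ge 1$, all real $p,q$ with $q\in(1,2]$ and $\frac1p+\frac1q=1$, and all $\epsilon$ with $0<\epsilon<0.04$. Consider the problem whose input is a matrix $A\in\mathbb{R}^{n\times d}$, accessible only through queries to its entries, with rows $A_1,\dots,A_n\in\mathbb{B}_p^d$, and whose task is to return a vector $\bar x\in\mathbb{B}_q^d$ such that $$A_j\bar x\ \ge\ \max_{x\in\mathbb{B}_q^d}\ \min_{1\le i\le n}A_i x-\epsilon\qquad\text{for all } j\in\{1,\dots,n\}.$$ 1. Every randomized classical algorithm that makes at most $T$ adaptive queries, each returning an entry $A_{ij}$ exactly, and that on every such $A$ succeeds in this task with probability at least $2/3$, has $T\ge c\,(n+d)$. 2. Every quantum algorithm that makes $T$ queries to the unitary oracle $O_A|i\rangle|j\rangle|z\rangle|w\rangle=|i\rangle|j\rangle|z\oplus A_{ij}\rangle|w\rangle$, where $A_{ij}$ is written into a register of bits in an arbitrary fixed encoding of the real numbers, $\oplus$ is bitwise XOR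 and $w$ is an arbitrary workspace, with arbitrary unitary operators independent of $A$ before, between and after the queries and a final measurement, and that on every such $A$ succeeds in this task with probability at least $2/3$, has $T\ge c\,(\sqrt n+\sqrt d)$. -/

import Mathlib

/-! The matrix game, and the classical and quantum query models for the entries of the matrix. -/

namespace MatrixGame

/-- The closed unit ball of the `ℓ_s`-norm in `ℝ^d`: all `x` with `∑ |x i| ^ s ≤ 1`. -/
def unitBall (s : ℝ) (d : ℕ) : Set (Fin d → ℝ) :=
  {x | ∑ i, |x i| ^ s ≤ 1}

/-- The value `max_{x in the ℓ_q ball} min_i A_i x` of the `ℓ_q`-`ℓ_1` matrix game, where `A_i` is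
the `i`-th row of `A`. For `n ≥ 1` the supremum is over a nonempty bounded set of reals. -/
noncomputable def gameValue {n d : ℕ} (q : ℝ) (A : Matrix (Fin n) (Fin d) ℝ) : ℝ :=
  ⨆ x : unitBall q d, ⨅ i : Fin n, A.mulVec (x : Fin d → ℝ) i

/-- `x` is an `ε`-optimal solution of the game: it lies in the `ℓ_q` ball, and `A_j x` is at least
the value of the game minus `ε` for every row `A_j`. -/
def IsSolution {n d : ℕ} (q ε : ℝ) (A : Matrix (Fin n) (Fin d) ℝ) (x : Fin d → ℝ) : Prop :=
  x ∈ unitBall q d ∧ ∀ j : Fin n, gameValue q A - ε ≤ A.mulVec x j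

/-- The inputs of the problem: matrices all of whose rows lie in the `ℓ_p` ball. -/
def IsInput {n d : ℕ} (p : ℝ) (A : Matrix (Fin n) (Fin d) ℝ) : Prop :=
  ∀ i : Fin n, A i ∈ unitBall p d

/-! ### Classical query algorithms -/

/-- A deterministic adaptive query algorithm for an `n × d` real matrix: it either stops with an
output vector, or asks for the entry at `(i, j)` and continues depending on the (exact, real)
answer. -/
inductive DecisionTree (n d : ℕ) : Type where
  | output (x : Fin d → ℝ) : DecisionTree n d
  | query (i : Fin n) (j : Fin d) (next : ℝ → DecisionTree n d) : DecisionTree n d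

/-- The vector that the algorithm returns on `A`. -/
def DecisionTree.run {n d : ℕ} (A : Matrix (Fin n) (Fin d) ℝ) :
    DecisionTree n d → (Fin d → ℝ)
  | .output x => x
  | .query i j next => (next (A i j)).run A

/-- The number of queries that the algorithm makes on `A`. -/
def DecisionTree.numQueries {n d : ℕ} (A : Matrix (Fin n) (Fin d) ℝ) :
    DecisionTree n d → ℕ
  | .output _ => 0
  | .query i j next => (next (A i j)).numQueries A + 1

/-- A randomized query algorithm is a family of deterministic ones, indexed by a random seed
`ω` with law `μ`. It solves the game to accuracy `ε` with `T` queries if, on every input, it makes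
at most `T` queries whatever the seed, and its output is an `ε`-optimal solution with probability
at least `2/3`. -/
def ClassicallySolves {n d : ℕ} {Ω : Type} [MeasurableSpace Ω] (p q ε : ℝ)
    (μ : MeasureTheory.Measure Ω) (alg : Ω → DecisionTree n d) (T : ℕ) : Prop :=
  ∀ A : Matrix (Fin n) (Fin d) ℝ, IsInput p A →
    (∀ ω, (alg ω).numQueries A ≤ T) ∧
    MeasurableSet {ω | IsSolution q ε A ((alg ω).run A)} ∧
    2 / 3 ≤ μ.real {ω | IsSolution q ε A ((alg ω).run A)}

/-! ### Quantum query algorithms -/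

/-- The labels `|i⟩|j⟩|z⟩|w⟩` of the computational basis: a row index, a column index, a value
register of bits indexed by `κ`, and a workspace with basis `W`. A finite `κ` gives a
floating-point register of dimension `2 ^ |κ|`; an infinite `κ` can hold real numbers exactly. -/
abbrev BasisLabel (n d : ℕ) (κ W : Type) : Type :=
  Fin n × Fin d × (κ → Bool) × W

/-- The Hilbert space with orthonormal basis `BasisLabel n d κ W`. -/
abbrev StateSpace (n d : ℕ) (κ W : Type) : Type :=
  lp (fun _ : BasisLabel n d κ W => ℂ) 2

/-- The action of the oracle on basis labels:
`(i, j, z, w) ↦ (i, j, z ⊕ A i j, w)`, where the real number `A i j` is written into the value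
register in the encoding `enc`, and `⊕` is bitwise XOR. -/
def oracleLabel {n d : ℕ} {κ W : Type} (enc : ℝ → κ → Bool) (A : Matrix (Fin n) (Fin d) ℝ)
    (s : BasisLabel n d κ W) : BasisLabel n d κ W :=
  (s.1, s.2.1, fun k => xor (s.2.2.1 k) (enc (A s.1 s.2.1) k), s.2.2.2)

theorem oracleLabel_involutive {n d : ℕ} {κ W : Type} (enc : ℝ → κ → Bool)
    (A : Matrix (Fin n) (Fin d) ℝ) :
    Function.Involutive (oracleLabel (W := W) enc A) := by
  rintro ⟨i, j, z, w⟩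
  simp [oracleLabel]

theorem memℓp_comp_of_involutive {ι : Type} {f : ι → ι} (hf : Function.Involutive f)
    (ψ : lp (fun _ : ι => ℂ) 2) : Memℓp (fun s => ψ (f s)) 2 := by
  have h := (lp.memℓp ψ).summable (by norm_num)
  exact memℓp_gen (h.comp_injective hf.injective)

/-- The quantum oracle `O_A`, the unitary operator with
`O_A |i⟩|j⟩|z⟩|w⟩ = |i⟩|j⟩|z ⊕ A i j⟩|w⟩`. Since the permutation `oracleLabel` of the basis is an
involution, the amplitude of `O_A ψ` at a label is that of `ψ` at the image of this label. -/
noncomputable def oracle {n d : ℕ} {κ W : Type} (enc : ℝ → κ → Bool)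
    (A : Matrix (Fin n) (Fin d) ℝ) : StateSpace n d κ W ≃ₗᵢ[ℂ] StateSpace n d κ W where
  toFun ψ := ⟨fun s => ψ (oracleLabel enc A s),
    memℓp_comp_of_involutive (oracleLabel_involutive enc A) ψ⟩
  invFun ψ := ⟨fun s => ψ (oracleLabel enc A s),
    memℓp_comp_of_involutive (oracleLabel_involutive enc A) ψ⟩
  map_add' ψ φ := by ext s; rfl
  map_smul' c ψ := by ext s; rfl
  left_inv ψ := by
    ext s
    exact congrArg ψ (oracleLabel_involutive enc A s)
  right_inv ψ := by
    ext s
    exact congrArg ψ (oracleLabel_involutive enc A s)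
  norm_map' ψ := by
    have h2 : (0 : ℝ) < (2 : ENNReal).toReal := by norm_num
    rw [lp.norm_eq_tsum_rpow h2, lp.norm_eq_tsum_rpow h2]
    congr 1
    exact (oracleLabel_involutive enc A).toPerm.tsum_eq (fun s => ‖ψ s‖ ^ (2 : ENNReal).toReal)

/-- A quantum query algorithm: an initial unit vector and a sequence of unitary operators, none of
which depends on the matrix, and a rule that turns the result of the final measurement in the
computational basis into a vector. -/
structure QuantumAlgorithm (n d : ℕ) (κ W : Type) where
  /-- the initial state -/
  init : StateSpace n d κ W
  /-- the initial state is a unit vector -/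
  norm_init : ‖init‖ = 1
  /-- the unitary operators applied before, between and after the queries -/
  unitary : ℕ → StateSpace n d κ W ≃ₗᵢ[ℂ] StateSpace n d κ W
  /-- the vector returned when the final measurement yields a given label -/
  output : BasisLabel n d κ W → Fin d → ℝ

/-- The state `U_T O_A U_{T-1} O_A ⋯ U_1 O_A U_0 ψ_0` of the algorithm after `T` queries. -/
noncomputable def QuantumAlgorithm.state {n d : ℕ} {κ W : Type} (alg : QuantumAlgorithm n d κ W)
    (enc : ℝ → κ → Bool) (A : Matrix (Fin n) (Fin d) ℝ) : ℕ → StateSpace n d κ W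
  | 0 => alg.unitary 0 alg.init
  | t + 1 => alg.unitary (t + 1) (oracle enc A (alg.state enc A t))

/-- The probability that the vector returned after `T` queries to `O_A` lies in `G`: the sum of the
squared amplitudes over the measurement results that lead to a vector in `G`. -/
noncomputable def QuantumAlgorithm.prob {n d : ℕ} {κ W : Type} (alg : QuantumAlgorithm n d κ W)
    (enc : ℝ → κ → Bool) (A : Matrix (Fin n) (Fin d) ℝ) (T : ℕ) (G : Set (Fin d → ℝ)) : ℝ :=
  ∑' s, (alg.output ⁻¹' G).indicator (fun s => ‖alg.state enc A T s‖ ^ 2) s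

/-- The quantum algorithm solves the game to accuracy `ε` with `T` queries: on every input, its
output is an `ε`-optimal solution with probability at least `2/3`. -/
def QuantumlySolves {n d : ℕ} {κ W : Type} (p q ε : ℝ) (enc : ℝ → κ → Bool)
    (alg : QuantumAlgorithm n d κ W) (T : ℕ) : Prop :=
  ∀ A : Matrix (Fin n) (Fin d) ℝ, IsInput p A →
    2 / 3 ≤ alg.prob enc A T {x | IsSolution q ε A x}

end MatrixGame

namespace MatrixGame

open MeasureTheory

/-! ### Solutions of the game on matrices with one nonzero column -/

/-! Solving the game hides two search problems. For rows, compare an all-ones column `j` with the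
same column after one sign flip: the first forces `0.96 ≤ x j`, the second `x j ≤ ε`, so no output
serves both and the flipped row must be noticed. For columns, compare the zero matrix with an
all-ones column `k`: a solution has `0.96 ≤ x k`, which by `eq_of_mem_unitBall_of_large` holds for
at most one `k`, so the output reveals `k`.

In both cases the family differs from its base in disjoint blocks (`AgreeOffBlocks`). Classically, a
run on the base touches at most `T` blocks, and its output is unchanged on all other members
(`DecisionTree.exists_card_le_run_eq`); double counting then gives linear bounds. Quantumly, the
query weight on the base is shared among the blocks, so the total squared displacement of the final
states is at most `4 T ^ 2` (`QuantumAlgorithm.sum_norm_state_sub_sq_le`), while success forces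
total displacement linear in the number of blocks. -/

theorem abs_le_one_of_mem_unitBall {s : ℝ} (hs : 0 < s) {d : ℕ} {x : Fin d → ℝ}
    (hx : x ∈ unitBall s d) (i : Fin d) : |x i| ≤ 1 := by
  by_contra! h
  have h1 : 1 < |x i| ^ s := Real.one_lt_rpow h hs
  have h2 : |x i| ^ s ≤ ∑ i, |x i| ^ s :=
    Finset.single_le_sum (f := fun i => |x i| ^ s) (fun j _ => by positivity) (Finset.mem_univ i)
  have h3 : ∑ i, |x i| ^ s ≤ 1 := hx
  linarith

theorem zero_mem_unitBall {s : ℝ} (hs : 0 < s) (d : ℕ) : (0 : Fin d → ℝ) ∈ unitBall s d := by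
  simp [unitBall, Real.zero_rpow hs.ne']

theorem single_mem_unitBall {s : ℝ} (hs : 0 < s) {d : ℕ} (j : Fin d) {a : ℝ} (ha : |a| ≤ 1) :
    (Pi.single j a : Fin d → ℝ) ∈ unitBall s d := by
  change ∑ i, |(Pi.single j a : Fin d → ℝ) i| ^ s ≤ 1
  rw [Finset.sum_eq_single j]
  · simpa using Real.rpow_le_one (abs_nonneg a) ha hs.le
  · intro i _ hi
    simp [hi, Real.zero_rpow hs.ne']
  · simp

/-- Since `q ≤ 2` and `0.96 ^ 2 > 1 / 2`, two such coordinates would overfill the ball. -/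
theorem eq_of_mem_unitBall_of_large {q : ℝ} (hq : 1 < q) (hq2 : q ≤ 2) {d : ℕ} {x : Fin d → ℝ}
    (hx : x ∈ unitBall q d) {j k : Fin d} (hj : 0.96 ≤ x j) (hk : 0.96 ≤ x k) : j = k := by
  by_contra hjk
  have key : ∀ i, 0.96 ≤ x i → 1 / 2 < |x i| ^ q := fun i hi => by
    have h0 : |x i| ≤ 1 := abs_le_one_of_mem_unitBall (by linarith) hx i
    have h1 : 0.96 ≤ |x i| := hi.trans (le_abs_self _)
    have h2 : |x i| ^ (2 : ℝ) ≤ |x i| ^ q :=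
      Real.rpow_le_rpow_of_exponent_ge (by linarith) h0 hq2
    rw [Real.rpow_two] at h2
    nlinarith
  have h1 : ∑ i ∈ {j, k}, |x i| ^ q ≤ ∑ i, |x i| ^ q :=
    Finset.sum_le_sum_of_subset_of_nonneg (Finset.subset_univ _) (fun i _ _ => by positivity)
  rw [Finset.sum_pair hjk] at h1
  have h2 : ∑ i, |x i| ^ q ≤ 1 := hx
  linarith [key j hj, key k hk]

theorem le_gameValue {n d : ℕ} {q : ℝ} (hq : 0 < q) (i₀ : Fin n) (A : Matrix (Fin n) (Fin d) ℝ)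
    {y : Fin d → ℝ} (hy : y ∈ unitBall q d) {v : ℝ} (hv : ∀ i, v ≤ A.mulVec y i) :
    v ≤ gameValue q A := by
  have : Nonempty (Fin n) := ⟨i₀⟩
  -- A real supremum is meaningful only when bounded; the ℓ₁ norm of row `i₀` suffices.
  have hbdd : BddAbove (Set.range fun x : unitBall q d =>
      ⨅ i : Fin n, A.mulVec (x : Fin d → ℝ) i) := by
    refine ⟨∑ j, |A i₀ j|, ?_⟩
    rintro _ ⟨x, rfl⟩
    refine (ciInf_le (Set.finite_range _).bddBelow i₀).trans ?_
    simp only [Matrix.mulVec, dotProduct]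
    refine Finset.sum_le_sum fun j _ => ?_
    calc A i₀ j * (x : Fin d → ℝ) j ≤ |A i₀ j * (x : Fin d → ℝ) j| := le_abs_self _
      _ = |A i₀ j| * |(x : Fin d → ℝ) j| := abs_mul _ _
      _ ≤ |A i₀ j| := mul_le_of_le_one_right (abs_nonneg _) (abs_le_one_of_mem_unitBall hq x.2 j)
  exact (le_ciInf hv).trans (le_ciSup hbdd ⟨y, hy⟩)

/-- The matrix whose column `j` is `σ` and whose other columns vanish. -/
def singleColumn {n d : ℕ} (σ : Fin n → ℝ) (j : Fin d) : Matrix (Fin n) (Fin d) ℝ :=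
  fun i => Pi.single j (σ i)

theorem singleColumn_mulVec {n d : ℕ} (σ : Fin n → ℝ) (j : Fin d) (x : Fin d → ℝ) (i : Fin n) :
    (singleColumn σ j).mulVec x i = σ i * x j := by
  simp [Matrix.mulVec, singleColumn]

theorem isInput_singleColumn {n d : ℕ} {p : ℝ} (hp : 0 < p) {σ : Fin n → ℝ}
    (hσ : ∀ i, |σ i| ≤ 1) (j : Fin d) : IsInput p (singleColumn σ j) :=
  fun i => single_mem_unitBall hp j (hσ i)

theorem IsSolution.le_of_singleColumn_one {n d : ℕ} {q ε : ℝ} (hq : 0 < q) (hε : ε < 0.04)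
    (i₀ : Fin n) {j : Fin d} {x : Fin d → ℝ}
    (hx : IsSolution q ε (singleColumn (1 : Fin n → ℝ) j) x) : 0.96 ≤ x j := by
  have h1 := hx.2 i₀
  have h2 : (1 : ℝ) ≤ gameValue q (singleColumn (1 : Fin n → ℝ) j) :=
    le_gameValue hq i₀ _ (single_mem_unitBall hq j (a := 1) (by simp))
      (fun i => by simp [singleColumn_mulVec])
  rw [singleColumn_mulVec] at h1
  simp only [Pi.one_apply, one_mul] at h1
  norm_num at *
  linarith

/-- Playing `0` guarantees value `0`, so the row with entry `-1` forces `x j ≤ ε`. -/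
theorem IsSolution.lt_of_singleColumn_neg {n d : ℕ} {q ε : ℝ} (hq : 0 < q) (hε : ε < 0.04)
    {σ : Fin n → ℝ} {i : Fin n} (hσ : σ i = -1) {j : Fin d} {x : Fin d → ℝ}
    (hx : IsSolution q ε (singleColumn σ j) x) : x j < 0.96 := by
  have h1 := hx.2 i
  have h2 : (0 : ℝ) ≤ gameValue q (singleColumn σ j) :=
    le_gameValue hq i _ (zero_mem_unitBall hq d) (fun i => by simp)
  rw [singleColumn_mulVec, hσ] at h1
  norm_num at *
  linarith

/-! ### Families of matrices that differ from a base matrix in disjoint blocks -/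

/-- The matrix `M k` agrees with `M₀` at all entries outside the block `b ⁻¹' {k}`. -/
def AgreeOffBlocks {n d m : ℕ} (b : Fin n → Fin d → Fin m) (M₀ : Matrix (Fin n) (Fin d) ℝ)
    (M : Fin m → Matrix (Fin n) (Fin d) ℝ) : Prop :=
  ∀ k i j, b i j ≠ k → M k i j = M₀ i j

/-- All ones in column `j`, and the sign in row `k` flipped. -/
def flippedColumn {n d : ℕ} (j : Fin d) (k : Fin n) : Matrix (Fin n) (Fin d) ℝ :=
  singleColumn (Function.update 1 k (-1)) j

theorem isInput_flippedColumn {n d : ℕ} {p : ℝ} (hp : 0 < p) (j : Fin d) (k : Fin n) :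
    IsInput p (flippedColumn j k) := by
  refine isInput_singleColumn hp (fun i => ?_) j
  by_cases h : i = k
  · subst h; simp
  · simp [h]

theorem agreeOffBlocks_flippedColumn {n d : ℕ} (j : Fin d) :
    AgreeOffBlocks (fun (i : Fin n) (_ : Fin d) => i) (singleColumn 1 j) (flippedColumn j) := by
  intro k i j' h
  simp [flippedColumn, singleColumn, Function.update_of_ne h]

theorem agreeOffBlocks_singleColumn {n d : ℕ} :
    AgreeOffBlocks (fun (_ : Fin n) (j : Fin d) => j) 0 (singleColumn 1) := by
  intro k i j h
  simp [singleColumn, h]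

/-! ### Classical algorithms -/

/-- The entries that a decision tree queries on the input `A`. -/
def DecisionTree.queried {n d : ℕ} (A : Matrix (Fin n) (Fin d) ℝ) :
    DecisionTree n d → Finset (Fin n × Fin d)
  | .output _ => ∅
  | .query i j next => insert (i, j) ((next (A i j)).queried A)

theorem DecisionTree.card_queried_le {n d : ℕ} (A : Matrix (Fin n) (Fin d) ℝ)
    (t : DecisionTree n d) : (t.queried A).card ≤ t.numQueries A := by
  induction t with
  | output x => simp [queried]
  | query i j next ih =>
    exact (Finset.card_insert_le _ _).trans (Nat.succ_le_succ (ih (A i j)))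

/-- Equal answers keep an adaptive run on the same path, so only the entries queried on `A` matter.
-/
theorem DecisionTree.run_congr {n d : ℕ} {A B : Matrix (Fin n) (Fin d) ℝ} (t : DecisionTree n d)
    (h : ∀ e ∈ t.queried A, B e.1 e.2 = A e.1 e.2) : t.run B = t.run A := by
  induction t with
  | output x => rfl
  | query i j next ih =>
    have hij : B i j = A i j := h (i, j) (Finset.mem_insert_self _ _)
    simp only [run, hij]
    exact ih (A i j) fun e he => h e (Finset.mem_insert_of_mem he)

/-- At most `T` blocks are touched on the base input, so that outside a set of `T` indices the
outputs on the base input and on the member of the family coincide. -/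
theorem DecisionTree.exists_card_le_run_eq {n d m : ℕ} {b : Fin n → Fin d → Fin m}
    {M₀ : Matrix (Fin n) (Fin d) ℝ} {M : Fin m → Matrix (Fin n) (Fin d) ℝ}
    (hM : AgreeOffBlocks b M₀ M) (t : DecisionTree n d) :
    ∃ S : Finset (Fin m), S.card ≤ t.numQueries M₀ ∧ ∀ k ∉ S, t.run (M k) = t.run M₀ := by
  refine ⟨(t.queried M₀).image fun e => b e.1 e.2,
    Finset.card_image_le.trans (t.card_queried_le M₀), fun k hk => t.run_congr fun e he => ?_⟩
  refine hM k _ _ fun h => hk ?_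
  exact Finset.mem_image.2 ⟨e, he, h⟩

/-- Double counting: if no point lies in more than `N` of the events, then their probabilities
add up to at most `N`. -/
theorem sum_measureReal_le_of_card_le {Ω ι : Type*} [Fintype ι] [MeasurableSpace Ω]
    (μ : Measure Ω) [IsProbabilityMeasure μ] {E : ι → Set Ω} (hE : ∀ k, MeasurableSet (E k))
    {N : ℕ} (h : ∀ ω, ∃ S : Finset ι, S.card ≤ N ∧ ∀ k, ω ∈ E k → k ∈ S) :
    ∑ k, μ.real (E k) ≤ N := by
  have hi : ∀ k, Integrable ((E k).indicator (1 : Ω → ℝ)) μ := fun k =>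
    (integrable_const (1 : ℝ)).indicator (hE k)
  calc ∑ k, μ.real (E k) = ∑ k, ∫ ω, (E k).indicator (1 : Ω → ℝ) ω ∂μ := by
        simp only [integral_indicator_one (hE _)]
    _ = ∫ ω, ∑ k, (E k).indicator (1 : Ω → ℝ) ω ∂μ := (integral_finsetSum _ fun k _ => hi k).symm
    _ ≤ ∫ _, (N : ℝ) ∂μ := by
        refine integral_mono (integrable_finsetSum _ fun k _ => hi k) (integrable_const _)
          fun ω => ?_
        obtain ⟨S, hS, hω⟩ := h ω
        calc ∑ k, (E k).indicator (1 : Ω → ℝ) ω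
            = ∑ k ∈ S, (E k).indicator (1 : Ω → ℝ) ω := by
              refine (Finset.sum_subset (Finset.subset_univ S) fun k _ hk => ?_).symm
              exact Set.indicator_of_notMem (fun hk' => hk (hω k hk')) _
          _ ≤ ∑ _k ∈ S, (1 : ℝ) :=
              Finset.sum_le_sum fun k _ => Set.indicator_le_self' (fun _ _ => zero_le_one) ω
          _ ≤ N := by simpa using hS
    _ = N := by simp

theorem ClassicallySolves.rows_le {n d : ℕ} {Ω : Type} [MeasurableSpace Ω] {μ : Measure Ω}
    [IsProbabilityMeasure μ] {p q ε : ℝ} {alg : Ω → DecisionTree n d} {T : ℕ} (hp : 0 < p)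
    (hq : 0 < q) (hε : ε < 0.04) (hn : 1 ≤ n) (hd : 1 ≤ d)
    (h : ClassicallySolves p q ε μ alg T) : (n : ℝ) ≤ 3 * T := by
  let i₀ : Fin n := ⟨0, hn⟩
  let j₀ : Fin d := ⟨0, hd⟩
  obtain ⟨hT, hm₀, hpr₀⟩ := h _ (isInput_singleColumn hp (σ := 1) (by simp) j₀)
  have hk := fun k => h _ (isInput_flippedColumn hp j₀ k)
  have hsum := sum_measureReal_le_of_card_le μ (fun k => hm₀.inter (hk k).2.1) (N := T)
    fun ω => by
      obtain ⟨S, hS, hrun⟩ := (alg ω).exists_card_le_run_eq (agreeOffBlocks_flippedColumn j₀)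
      refine ⟨S, hS.trans (hT ω), fun k ⟨h₀, h₁⟩ => ?_⟩
      by_contra hkS
      have h₀' := IsSolution.le_of_singleColumn_one hq hε i₀ h₀
      have h₁' := IsSolution.lt_of_singleColumn_neg hq hε (i := k) (by simp) h₁
      rw [hrun k hkS] at h₁'
      exact absurd h₀' (not_le.2 h₁')
  -- Two events of probability at least `2/3` meet with probability at least `1/3`.
  have hlow : ∀ k, (1 / 3 : ℝ) ≤ μ.real
      ({ω | IsSolution q ε (singleColumn (1 : Fin n → ℝ) j₀) ((alg ω).run (singleColumn 1 j₀))} ∩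
        {ω | IsSolution q ε (flippedColumn j₀ k) ((alg ω).run (flippedColumn j₀ k))}) := by
    intro k
    have hunion := measureReal_union_add_inter (μ := μ)
      (s := {ω | IsSolution q ε (singleColumn (1 : Fin n → ℝ) j₀)
        ((alg ω).run (singleColumn 1 j₀))})
      (hk k).2.1
    have hle : μ.real
        ({ω | IsSolution q ε (singleColumn (1 : Fin n → ℝ) j₀)
          ((alg ω).run (singleColumn 1 j₀))} ∪
        {ω | IsSolution q ε (flippedColumn j₀ k) ((alg ω).run (flippedColumn j₀ k))}) ≤ 1 :=
      measureReal_le_one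
    linarith [(hk k).2.2]
  have := (Finset.sum_le_sum fun k (_ : k ∈ Finset.univ) => hlow k).trans hsum
  simp only [Finset.sum_const, Finset.card_univ, Fintype.card_fin, nsmul_eq_mul] at this
  linarith

theorem ClassicallySolves.cols_le {n d : ℕ} {Ω : Type} [MeasurableSpace Ω] {μ : Measure Ω}
    [IsProbabilityMeasure μ] {p q ε : ℝ} {alg : Ω → DecisionTree n d} {T : ℕ} (hp : 0 < p)
    (hq : 1 < q) (hq2 : q ≤ 2) (hε : ε < 0.04) (hn : 1 ≤ n)
    (h : ClassicallySolves p q ε μ alg T) : 2 / 3 * (d : ℝ) ≤ T + 1 := by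
  let i₀ : Fin n := ⟨0, hn⟩
  have hT := (h 0 fun i => zero_mem_unitBall hp d).1
  have hk := fun k : Fin d => h _ (isInput_singleColumn hp (σ := 1) (by simp) k)
  -- The extra `1` pays for a lucky guess: the output on the zero matrix can be right for one
  -- untouched column.
  have hsum := sum_measureReal_le_of_card_le μ (fun k => (hk k).2.1) (N := T + 1)
    fun ω => by
      obtain ⟨S, hS, hrun⟩ := (alg ω).exists_card_le_run_eq
        (agreeOffBlocks_singleColumn (n := n) (d := d))
      have huniq : ∀ k ∉ S, ω ∈ {ω | IsSolution q ε (singleColumn (1 : Fin n → ℝ) k)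
          ((alg ω).run (singleColumn 1 k))} →
          (alg ω).run 0 ∈ unitBall q d ∧ 0.96 ≤ (alg ω).run 0 k := by
        intro k hkS hω
        have h1 : IsSolution q ε (singleColumn (1 : Fin n → ℝ) k)
          ((alg ω).run (singleColumn 1 k)) := hω
        rw [hrun k hkS] at h1
        exact ⟨h1.1, h1.le_of_singleColumn_one (by linarith) hε i₀⟩
      by_cases hex : ∃ k ∉ S, ω ∈ {ω | IsSolution q ε (singleColumn (1 : Fin n → ℝ) k)
          ((alg ω).run (singleColumn 1 k))}
      · obtain ⟨k, hkS, hωk⟩ := hex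
        refine ⟨insert k S, (Finset.card_insert_le _ _).trans
          (Nat.succ_le_succ (hS.trans (hT ω))), fun l hωl => ?_⟩
        by_cases hlS : l ∈ S
        · exact Finset.mem_insert_of_mem hlS
        · have := eq_of_mem_unitBall_of_large hq hq2 (huniq k hkS hωk).1 (huniq k hkS hωk).2
            (huniq l hlS hωl).2
          exact this ▸ Finset.mem_insert_self _ _
      · push Not at hex
        refine ⟨S, (hS.trans (hT ω)).trans (Nat.le_succ _), fun k hωk => ?_⟩
        by_contra hkS
        exact hex k hkS hωk
  have := (Finset.sum_le_sum fun k (_ : k ∈ Finset.univ) => (hk k).2.2).trans hsum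
  simp only [Finset.sum_const, Finset.card_univ, Fintype.card_fin, nsmul_eq_mul] at this
  push_cast at this
  linarith

/-! ### Quantum algorithms: the hybrid argument -/

section Weight

variable {ι : Type}

/-- The squared norm of the projection of `ψ` to the span of the basis vectors in `S`. -/
noncomputable def weight (ψ : lp (fun _ : ι => ℂ) 2) (S : Set ι) : ℝ :=
  ∑' s, S.indicator (fun s => ‖ψ s‖ ^ 2) s

theorem summable_norm_sq (ψ : lp (fun _ : ι => ℂ) 2) : Summable fun s => ‖ψ s‖ ^ 2 := by
  simpa using (lp.memℓp ψ).summable (by norm_num)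

theorem summable_weight (ψ : lp (fun _ : ι => ℂ) 2) (S : Set ι) :
    Summable (S.indicator fun s => ‖ψ s‖ ^ 2) :=
  (summable_norm_sq ψ).indicator S

theorem norm_sq_eq_tsum (ψ : lp (fun _ : ι => ℂ) 2) : ‖ψ‖ ^ 2 = ∑' s, ‖ψ s‖ ^ 2 := by
  simpa using lp.norm_rpow_eq_tsum (p := 2) (by norm_num) ψ

/-- This is `(a + b)² ≤ 5/4 a² + 5 b²`, from `(a - 4b)² ≥ 0`. The symmetric constants `2, 2` would
leave no gap in the row bound, where `a²` sums to at most `1/3` and the target is `2/3`. -/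
theorem weight_le_add (ψ φ : lp (fun _ : ι => ℂ) 2) (S : Set ι) :
    weight ψ S ≤ 5 / 4 * weight φ S + 5 * ‖ψ - φ‖ ^ 2 := by
  rw [norm_sq_eq_tsum, weight, weight, ← tsum_mul_left, ← tsum_mul_left,
    ← ((summable_weight φ S).mul_left _).tsum_add ((summable_norm_sq (ψ - φ)).mul_left _)]
  refine (summable_weight ψ S).tsum_le_tsum (fun s => ?_)
    (((summable_weight φ S).mul_left _).add ((summable_norm_sq (ψ - φ)).mul_left _))
  by_cases hs : s ∈ S
  · simp only [Set.indicator_of_mem hs, lp.coeFn_sub, Pi.sub_apply]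
    have h1 : ‖ψ s‖ ≤ ‖φ s‖ + ‖ψ s - φ s‖ := norm_le_norm_add_norm_sub' _ _
    nlinarith [norm_nonneg (ψ s), sq_nonneg (‖φ s‖ - 4 * ‖ψ s - φ s‖),
      pow_le_pow_left₀ (norm_nonneg (ψ s)) h1 2]
  · simp only [Set.indicator_of_notMem hs]
    positivity

theorem sum_weight_le {κ : Type*} [Fintype κ] (ψ : lp (fun _ : ι => ℂ) 2) {S : κ → Set ι}
    (hS : Pairwise fun k l => Disjoint (S k) (S l)) : ∑ k, weight ψ (S k) ≤ ‖ψ‖ ^ 2 := by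
  rw [norm_sq_eq_tsum]
  unfold weight
  rw [← Summable.tsum_finsetSum fun k _ => summable_weight ψ (S k)]
  refine (summable_sum fun k _ => summable_weight ψ (S k)).tsum_le_tsum (fun s => ?_)
    (summable_norm_sq ψ)
  by_cases hs : ∃ k, s ∈ S k
  · obtain ⟨k, hk⟩ := hs
    rw [Finset.sum_eq_single k]
    · rw [Set.indicator_of_mem hk]
    · intro l _ hl
      exact Set.indicator_of_notMem (fun h => Set.disjoint_left.1 (hS hl) h hk) _
    · simp
  · push Not at hs
    rw [Finset.sum_eq_zero fun k _ => Set.indicator_of_notMem (hs k) _]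
    positivity

theorem weight_comp_involutive {f : ι → ι} (hf : Function.Involutive f) {S : Set ι}
    (hS : ∀ s, f s ∈ S ↔ s ∈ S) (ψ : lp (fun _ : ι => ℂ) 2) :
    HasSum (S.indicator fun s => ‖ψ (f s)‖ ^ 2) (weight ψ S) := by
  have h := (hf.toPerm f).hasSum_iff.2 (summable_weight ψ S).hasSum
  change HasSum _ (weight ψ S) at h
  convert h using 1
  funext s
  by_cases hs : s ∈ S
  · have : f s ∈ S := (hS s).2 hs
    simp [hs, this]
  · have : f s ∉ S := fun h => hs ((hS s).1 h)
    simp [hs, this]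

end Weight

section Hybrid

variable {n d m : ℕ} {κ W : Type}

/-- The basis labels whose query position lies in the block `k`. -/
def blockLabels (b : Fin n → Fin d → Fin m) (k : Fin m) : Set (BasisLabel n d κ W) :=
  {s | b s.1 s.2.1 = k}

/-- Amplitudes outside the block cancel. Inside, `‖u - v‖² ≤ 2‖u‖² + 2‖v‖²`, and both oracles
permute the block's labels, as they change only the value register. -/
theorem norm_oracle_sub_sq_le {b : Fin n → Fin d → Fin m} {M₀ : Matrix (Fin n) (Fin d) ℝ}
    {M : Fin m → Matrix (Fin n) (Fin d) ℝ} (hM : AgreeOffBlocks b M₀ M) (enc : ℝ → κ → Bool)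
    (ψ : StateSpace n d κ W) (k : Fin m) :
    ‖oracle enc (M k) ψ - oracle enc M₀ ψ‖ ^ 2 ≤ 4 * weight ψ (blockLabels b k) := by
  have h1 := weight_comp_involutive (oracleLabel_involutive (W := W) enc (M k))
    (S := blockLabels b k) (fun _ => Iff.rfl) ψ
  have h2 := weight_comp_involutive (oracleLabel_involutive (W := W) enc M₀)
    (S := blockLabels b k) (fun _ => Iff.rfl) ψ
  have h3 := (h1.mul_left 2).add (h2.mul_left 2)
  rw [norm_sq_eq_tsum]
  refine ((summable_norm_sq _).tsum_le_tsum (fun s => ?_) h3.summable).trans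
    (h3.tsum_eq.trans (by ring)).le
  change ‖ψ (oracleLabel enc (M k) s) - ψ (oracleLabel enc M₀ s)‖ ^ 2 ≤ _
  by_cases hs : s ∈ blockLabels b k
  · simp only [Set.indicator_of_mem hs]
    have h := norm_sub_le (ψ (oracleLabel enc (M k) s)) (ψ (oracleLabel enc M₀ s))
    have h' := pow_le_pow_left₀ (norm_nonneg _) h 2
    nlinarith [sq_nonneg (‖ψ (oracleLabel enc (M k) s)‖ - ‖ψ (oracleLabel enc M₀ s)‖)]
  · have : oracleLabel enc (M k) s = oracleLabel enc M₀ s := by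
      simp only [oracleLabel, hM k s.1 s.2.1 hs]
    simp [this, Set.indicator_of_notMem hs]

theorem QuantumAlgorithm.norm_state (alg : QuantumAlgorithm n d κ W) (enc : ℝ → κ → Bool)
    (A : Matrix (Fin n) (Fin d) ℝ) (t : ℕ) : ‖alg.state enc A t‖ = 1 := by
  induction t with
  | zero => simp [state, alg.norm_init]
  | succ t ih => simp [state, ih]

/-- Oracles are exchanged one at a time. All errors are measured along the run on `B`, so that for a
whole family they refer to one sequence of states. -/
theorem QuantumAlgorithm.norm_state_sub_le (alg : QuantumAlgorithm n d κ W) (enc : ℝ → κ → Bool)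
    (A B : Matrix (Fin n) (Fin d) ℝ) (T : ℕ) :
    ‖alg.state enc A T - alg.state enc B T‖ ≤
      ∑ t ∈ Finset.range T,
        ‖oracle enc A (alg.state enc B t) - oracle enc B (alg.state enc B t)‖ := by
  induction T with
  | zero => simp [state]
  | succ T ih =>
    rw [Finset.sum_range_succ]
    simp only [state]
    rw [← map_sub, LinearIsometryEquiv.norm_map]
    refine (norm_sub_le_norm_sub_add_norm_sub _ (oracle enc A (alg.state enc B T)) _).trans
      (add_le_add ?_ le_rfl)
    rwa [← map_sub, LinearIsometryEquiv.norm_map]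

/-- The hybrid argument: `T` queries move the final states on the members of the family away from
the final state on the base input by at most `4 T ^ 2` in total squared distance. -/
theorem QuantumAlgorithm.sum_norm_state_sub_sq_le {b : Fin n → Fin d → Fin m}
    {M₀ : Matrix (Fin n) (Fin d) ℝ} {M : Fin m → Matrix (Fin n) (Fin d) ℝ}
    (hM : AgreeOffBlocks b M₀ M) (alg : QuantumAlgorithm n d κ W) (enc : ℝ → κ → Bool) (T : ℕ) :
    ∑ k, ‖alg.state enc (M k) T - alg.state enc M₀ T‖ ^ 2 ≤ 4 * (T : ℝ) ^ 2 := by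
  have hk : ∀ k, ‖alg.state enc (M k) T - alg.state enc M₀ T‖ ^ 2 ≤
      T * ∑ t ∈ Finset.range T, 4 * weight (alg.state enc M₀ t) (blockLabels b k) := by
    intro k
    refine (pow_le_pow_left₀ (norm_nonneg _) (alg.norm_state_sub_le enc _ _ T) 2).trans ?_
    -- Cauchy–Schwarz over the `T` queries.
    refine (sq_sum_le_card_mul_sum_sq).trans ?_
    rw [Finset.card_range]
    gcongr with t ht
    exact norm_oracle_sub_sq_le hM enc _ k
  calc _ ≤ ∑ k, T * ∑ t ∈ Finset.range T,
          4 * weight (alg.state enc M₀ t) (blockLabels b k) :=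
        Finset.sum_le_sum fun k _ => hk k
    _ = T * ∑ t ∈ Finset.range T,
          4 * ∑ k, weight (alg.state enc M₀ t) (blockLabels b k) := by
        rw [← Finset.mul_sum, Finset.sum_comm]
        simp only [Finset.mul_sum]
    _ ≤ T * ∑ t ∈ Finset.range T, 4 * 1 := by
        gcongr with t ht
        refine (sum_weight_le _ fun k l hkl => ?_).trans_eq
          (by rw [alg.norm_state enc M₀ t, one_pow])
        exact Set.disjoint_left.2 fun s hs hs' => hkl (hs.symm.trans hs')
    _ = 4 * (T : ℝ) ^ 2 := by simp; ring

theorem QuantumlySolves.rows_le {p q ε : ℝ} {enc : ℝ → κ → Bool} {alg : QuantumAlgorithm n d κ W}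
    {T : ℕ} (hp : 0 < p) (hq : 0 < q) (hε : ε < 0.04) (hn : 1 ≤ n) (hd : 1 ≤ d)
    (h : QuantumlySolves p q ε enc alg T) : (n : ℝ) ≤ 80 * (T : ℝ) ^ 2 := by
  let i₀ : Fin n := ⟨0, hn⟩
  let j₀ : Fin d := ⟨0, hd⟩
  have h₀ := h _ (isInput_singleColumn hp (σ := 1) (by simp) j₀)
  have hlow : ∀ k, (1 / 20 : ℝ) ≤ ‖alg.state enc (flippedColumn j₀ k) T -
      alg.state enc (singleColumn 1 j₀) T‖ ^ 2 := by
    intro k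
    -- The base state has weight at most `1/3` on the labels good for the flipped matrix, so `2/3 ≤
    -- 5/12 + 5 δ²` and `δ² ≥ 1/20`.
    have h₁ := h _ (isInput_flippedColumn hp j₀ k)
    have hw := weight_le_add (alg.state enc (flippedColumn j₀ k) T)
      (alg.state enc (singleColumn 1 j₀) T)
      (alg.output ⁻¹' {x | IsSolution q ε (flippedColumn j₀ k) x})
    have hdisj : Disjoint (alg.output ⁻¹' {x | IsSolution q ε (singleColumn 1 j₀) x})
        (alg.output ⁻¹' {x | IsSolution q ε (flippedColumn j₀ k) x}) :=
      Set.disjoint_left.2 fun s hs hs' =>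
        absurd (IsSolution.le_of_singleColumn_one hq hε i₀ hs)
          (not_le.2 (IsSolution.lt_of_singleColumn_neg hq hε (i := k) (by simp) hs'))
    have hsum := sum_weight_le (alg.state enc (singleColumn 1 j₀) T)
      (S := fun c : Bool => cond c
        (alg.output ⁻¹' {x | IsSolution q ε (singleColumn 1 j₀) x})
        (alg.output ⁻¹' {x | IsSolution q ε (flippedColumn j₀ k) x}))
      (by rintro (_ | _) (_ | _) hne
          · exact absurd rfl hne
          · exact hdisj.symm
          · exact hdisj
          · exact absurd rfl hne)
    rw [alg.norm_state, Fintype.sum_bool] at hsum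
    simp only [cond_true, cond_false] at hsum
    simp only [QuantumAlgorithm.prob] at h₀ h₁
    simp only [weight] at hw hsum
    linarith
  have := (Finset.sum_le_sum fun k (_ : k ∈ Finset.univ) => hlow k).trans
    (alg.sum_norm_state_sub_sq_le (agreeOffBlocks_flippedColumn j₀) enc T)
  simp only [Finset.sum_const, Finset.card_univ, Fintype.card_fin, nsmul_eq_mul] at this
  linarith

theorem QuantumlySolves.cols_le {p q ε : ℝ} {enc : ℝ → κ → Bool} {alg : QuantumAlgorithm n d κ W}
    {T : ℕ} (hp : 0 < p) (hq : 1 < q) (hq2 : q ≤ 2) (hε : ε < 0.04) (hn : 1 ≤ n)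
    (h : QuantumlySolves p q ε enc alg T) :
    2 / 3 * (d : ℝ) ≤ 5 / 4 + 20 * (T : ℝ) ^ 2 := by
  let i₀ : Fin n := ⟨0, hn⟩
  let S : Fin d → Set (BasisLabel n d κ W) := fun k =>
    alg.output ⁻¹' {x | IsSolution q ε (singleColumn (1 : Fin n → ℝ) k) x}
  have hk : ∀ k, (2 / 3 : ℝ) ≤ 5 / 4 * weight (alg.state enc 0 T) (S k) +
      5 * ‖alg.state enc (singleColumn 1 k) T - alg.state enc 0 T‖ ^ 2 := fun k =>
    (h _ (isInput_singleColumn hp (σ := 1) (by simp) k)).trans (weight_le_add _ _ (S k))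
  have hsum := sum_weight_le (alg.state enc 0 T) (S := S) fun k l hkl =>
    Set.disjoint_left.2 fun s hs hs' => hkl <| eq_of_mem_unitBall_of_large hq hq2 hs.1
      (IsSolution.le_of_singleColumn_one (by linarith) hε i₀ hs)
      (IsSolution.le_of_singleColumn_one (by linarith) hε i₀ hs')
  rw [alg.norm_state] at hsum
  have hdist := alg.sum_norm_state_sub_sq_le
    (agreeOffBlocks_singleColumn (n := n) (d := d)) enc T
  have := Finset.sum_le_sum fun k (_ : k ∈ Finset.univ) => hk k
  rw [Finset.sum_add_distrib, ← Finset.mul_sum, ← Finset.mul_sum] at this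
  simp only [Finset.sum_const, Finset.card_univ, Fintype.card_fin, nsmul_eq_mul] at this
  linarith

end Hybrid

end MatrixGame

/-! ### Combining the row and column bounds -/

theorem theorem5 :
    ∃ c : ℝ, 0 < c ∧
      ∀ (n d : ℕ), 1 ≤ n → 1 ≤ d →
      ∀ (p q : ℝ), 1 < q → q ≤ 2 → 1 / p + 1 / q = 1 →
      ∀ (ε : ℝ), 0 < ε → ε < 0.04 →
      -- classical lower bound
      (∀ (Ω : Type) [MeasurableSpace Ω] (μ : MeasureTheory.Measure Ω)
          [MeasureTheory.IsProbabilityMeasure μ]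
          (alg : Ω → MatrixGame.DecisionTree n d) (T : ℕ),
          MatrixGame.ClassicallySolves p q ε μ alg T →
          c * ((n : ℝ) + (d : ℝ)) ≤ (T : ℝ)) ∧
      -- quantum lower bound
      (∀ (κ W : Type) (enc : ℝ → κ → Bool)
          (alg : MatrixGame.QuantumAlgorithm n d κ W) (T : ℕ),
          MatrixGame.QuantumlySolves p q ε enc alg T →
          c * (Real.sqrt n + Real.sqrt d) ≤ (T : ℝ)) := by
  -- Both square roots are at most `22 * T`, as `480 ≤ 22 ^ 2`.
  refine ⟨1 / 44, by norm_num, fun n d hn hd p q hq hq2 hpq ε _ hε => ?_⟩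
  have hp : 0 < p := by
    have h1 : 1 / q < 1 := by
      rw [div_lt_one (by linarith)]
      exact hq
    exact one_div_pos.1 (by linarith)
  have hq0 : 0 < q := by linarith
  have hn' : (1 : ℝ) ≤ n := by exact_mod_cast hn
  -- At `d = 1` the column bounds say nothing and the row bound gives `T > 0`; for `d ≥ 2` their
  -- additive constants are absorbed into `d`.
  have hd' : d = 1 ∨ (2 : ℝ) ≤ d := by
    rcases hd.eq_or_lt with h | h
    · exact Or.inl h.symm
    · exact Or.inr (by exact_mod_cast h)
  refine ⟨fun Ω _ μ _ alg T h => ?_, fun κ W enc alg T h => ?_⟩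
  · have hrows := h.rows_le hp hq0 hε hn hd
    have hcols := h.cols_le hp hq hq2 hε hn
    have hdT : (d : ℝ) ≤ 6 * T := by
      rcases hd' with rfl | hd'
      · push_cast
        linarith
      · linarith
    linarith
  · have hrows := h.rows_le hp hq0 hε hn hd
    have hcols := h.cols_le hp hq hq2 hε hn
    have hdT : (d : ℝ) ≤ 480 * (T : ℝ) ^ 2 := by
      rcases hd' with rfl | hd'
      · push_cast
        linarith
      · linarith
    have h1 : Real.sqrt n ≤ 22 * T := Real.sqrt_le_iff.2 ⟨by positivity, by nlinarith⟩
    have h2 : Real.sqrt d ≤ 22 * T := Real.sqrt_le_iff.2 ⟨by positivity, by nlinarith⟩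
    linarith
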